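/- There are $N\ge 2$ arms $1,\dots,N$. When arms $i\neq j$ duel, $i$ wins with probability $p_{i,j}=1-p_{j,i}$, independently of the past given the pair of arms. Assume that the arms are totally ordered, i.e. $p_{i,j}>\tfrac12$ for all $i<j$ (so arm $1$ is the best arm), and let $p=\min\{p_{i,j} : p_{i,j}>\tfrac12\}$. Let $C(t,i)$ be the number of duels won minus the number of duels lost by arm $i$ up to and including time $t$, with $C(0,i)=0$. The Winner Stays algorithm for weak regret (WS-W) pulls at each time $t=1,2,\dots$ a pair of arms $(i_t,j_t)$ as follows. First, $i_t\in M:=\arg\max_i C(t-1,i)$, where $i_t=i_{t-1}$ if $t>1$ and $i_{t-1}\in M$; else $i_t=j_{t-1}$ if $t>1$ and $j_{t-1}\in M$; else $i_t$ is uniformly random in $M$. Then $j_t\in M':=\arg\max_{j\ne i_t}C(t-1,j)$, where $j_t=i_{t-1}$ if $t>1$ and $i_{t-1}\in M'$; else $j_t=j_{t-1}$ if $t>1$ and $j_{t-1}\in M'$; else $j_t$ is uniformly random in $M'$. The duel of $i_t$ and $j_t$ is then observed. The weak regret at time $t$ is $r(t)=0$ if $1\in\{i_t,j_t\}$ and $r(t)=1$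 otherwise. Then the expected cumulative weak regret of WS-W over the infinite horizon satisfies $$\mathbb E\Big[\sum_{t=1}^{\infty} r(t)\Big]\le \frac{2p^3}{(2p-1)^6}\,N(\log N+1)+\frac{N}{(2p-1)^2},$$ where $\log$ is the natural logarithm. In particular the same bound, which does not depend on $T$, holds for $\mathbb E\big[\sum_{t=1}^{T} r(t)\big]$ for every $T$. For fixed $p$, the bound is $O(N\log N)$ as $N\to\infty$. -/

import Mathlib

open MeasureTheory ProbabilityTheory
open scoped ENNReal

/-- Pairwise preference probabilities of `N` arms: `prob i j` is the probability that arm `i` wins a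
duel between the arms `i` and `j`. -/
structure Preference (N : ℕ) where
  prob : Fin N → Fin N → ℝ
  nonneg : ∀ i j, 0 ≤ prob i j
  symm : ∀ i j, prob i j = 1 - prob j i

/-- The arms are totally ordered: arm `i` is better than arm `j` whenever `i < j`.  In particular
the arm with index `0` is the best arm. -/
def Preference.IsTotalOrder {N : ℕ} (P : Preference N) : Prop :=
  ∀ i j, i < j → 1 / 2 < P.prob i j

/-- `p` is the minimum of those `prob i j` that exceed `1 / 2`. -/
def Preference.IsMinWinProb {N : ℕ} (P : Preference N) (p : ℝ) : Prop :=
  IsLeast {x | 1 / 2 < x ∧ ∃ i j, P.prob i j = x} p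

/-- The record `(i, j, b)` of one duel: the arms `i` and `j` were pulled, in this order, and `b`
tells whether `i` won (`true`) or `j` won (`false`). -/
abbrev Duel (N : ℕ) := Fin N × Fin N × Bool

namespace WSW

/-- Arm `a` defeated arm `b` in the duel `d`. -/
def Defeats {N : ℕ} (d : Duel N) (a b : Fin N) : Prop :=
  d = (a, b, true) ∨ d = (b, a, false)

instance {N : ℕ} (d : Duel N) (a b : Fin N) : Decidable (Defeats d a b) :=
  inferInstanceAs (Decidable (_ ∨ _))

/-- `q_{a,b}`: the number of times that `a` has defeated `b` in the first `t` duels. -/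
def numDefeats {N t : ℕ} (h : Fin t → Duel N) (a b : Fin N) : ℕ :=
  (Finset.univ.filter fun s => Defeats (h s) a b).card

/-- `C(t, a)`: duels won minus duels lost by the arm `a` in the first `t` duels. -/
def score {N t : ℕ} (h : Fin t → Duel N) (a : Fin N) : ℤ :=
  ∑ b ∈ Finset.univ.erase a, ((numDefeats h a b : ℤ) - (numDefeats h b a : ℤ))

/-- The maximizers of `C` over the finite set `S`. -/
def argmaxOn {N : ℕ} (C : Fin N → ℤ) (S : Finset (Fin N)) : Finset (Fin N) :=
  S.filter fun a => ∀ b ∈ S, C b ≤ C a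

theorem argmaxOn_nonempty {N : ℕ} (C : Fin N → ℤ) {S : Finset (Fin N)} (hS : S.Nonempty) :
    (argmaxOn C S).Nonempty := by
  obtain ⟨a, ha, hmax⟩ := Finset.exists_max_image S C hS
  exact ⟨a, Finset.mem_filter.mpr ⟨ha, hmax⟩⟩

/-- The most recent duel, if there is one. -/
def lastDuel {N : ℕ} : {t : ℕ} → (Fin t → Duel N) → Option (Duel N)
  | 0, _ => none
  | n + 1, h => some (h (Fin.last n))

/-- Tie breaking: the set of maximizers `M` is narrowed to the previous first arm if it lies in `M`,
else to the previous second arm if it lies in `M`, and else it is kept. -/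
def tieBreak {N : ℕ} (prev : Option (Duel N)) (M : Finset (Fin N)) : Finset (Fin N) :=
  match prev with
  | none => M
  | some d => if d.1 ∈ M then {d.1} else if d.2.1 ∈ M then {d.2.1} else M

theorem tieBreak_nonempty {N : ℕ} (prev : Option (Duel N)) {M : Finset (Fin N)}
    (hM : M.Nonempty) : (tieBreak prev M).Nonempty := by
  unfold tieBreak
  split
  · exact hM
  · split_ifs <;> simp [hM]

theorem univ_nonempty' (N : ℕ) [N.AtLeastTwo] : (Finset.univ : Finset (Fin N)).Nonempty :=
  ⟨0, Finset.mem_univ _⟩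

theorem erase_nonempty' {N : ℕ} [N.AtLeastTwo] (i : Fin N) :
    ((Finset.univ : Finset (Fin N)).erase i).Nonempty := by
  have : Nontrivial (Fin N) := Fin.nontrivial_iff_two_le.mpr Nat.AtLeastTwo.prop
  obtain ⟨j, hj⟩ := exists_ne i
  exact ⟨j, Finset.mem_erase.mpr ⟨hj, Finset.mem_univ _⟩⟩

/-- The arm with the largest score in `S`; ties are broken by `tieBreak` and then uniformly at
random. -/
noncomputable def pickArm {N t : ℕ} (h : Fin t → Duel N) (S : Finset (Fin N)) (hS : S.Nonempty) :
    PMF (Fin N) :=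
  PMF.uniformOfFinset (tieBreak (lastDuel h) (argmaxOn (score h) S))
    (tieBreak_nonempty _ (argmaxOn_nonempty _ hS))

/-- The binary feedback of a duel of `i` against `j`: `true` (`i` wins) has probability
`prob i j`, and `false` (`j` wins) has probability `prob j i = 1 - prob i j`. -/
noncomputable def feedback {N : ℕ} (P : Preference N) (i j : Fin N) : PMF Bool :=
  PMF.ofFintype (fun b => ENNReal.ofReal (if b then P.prob i j else P.prob j i)) (by
    have h := P.symm i j
    rw [Fintype.sum_bool, ← ENNReal.ofReal_add (by simpa using P.nonneg i j)
      (by simpa using P.nonneg j i)]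
    simp [h])

/-- One step of Winner Stays for weak regret: the conditional law of the next duel given the
history `h` of all previous duels. -/
noncomputable def step {N t : ℕ} [N.AtLeastTwo] (P : Preference N) (h : Fin t → Duel N) :
    PMF (Duel N) :=
  (pickArm h Finset.univ (univ_nonempty' N)).bind fun i =>
    (pickArm h (Finset.univ.erase i) (erase_nonempty' i)).bind fun j =>
      (feedback P i j).map fun b => (i, j, b)

/-- The `n + 1` duels with time indices `0, …, n`, as a history. -/
def history {N n : ℕ} (h : (s : Finset.Iic n) → Duel N) : Fin (n + 1) → Duel N :=
  fun s => h ⟨s, Finset.mem_Iic.mpr (Nat.lt_succ_iff.mp s.isLt)⟩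

/-- The algorithm as a sequence of Markov kernels from histories to the next duel. -/
noncomputable def kernel {N : ℕ} [N.AtLeastTwo] (P : Preference N) (n : ℕ) :
    Kernel ((s : Finset.Iic n) → Duel N) (Duel N) :=
  Kernel.ofFunOfCountable fun h => (step P (history h)).toMeasure

instance {N : ℕ} [N.AtLeastTwo] (P : Preference N) (n : ℕ) : IsMarkovKernel (kernel P n) :=
  ⟨fun h => PMF.toMeasure.isProbabilityMeasure (step P (history h))⟩

/-- The law of the infinite sequence of duels `ω 0, ω 1, …` of Winner Stays for weak regret, where
`ω t` is the duel at time `t + 1`. -/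
noncomputable def law {N : ℕ} [N.AtLeastTwo] (P : Preference N) : Measure (ℕ → Duel N) :=
  Kernel.trajMeasure (X := fun _ => Duel N)
    (step P (Fin.elim0 : Fin 0 → Duel N)).toMeasure (kernel P)

/-- The single-period weak regret: `0` if the best arm is pulled and `1` otherwise. -/
noncomputable def weakRegret {N : ℕ} (best : Fin N) (d : Duel N) : ℝ≥0∞ :=
  if d.1 = best ∨ d.2.1 = best then 0 else 1

end WSW

/-! Scores organise the play into rounds and series. In round `l` an incumbent meets the arms of
score `1 - l` one after another; a series lasts until one of its two arms falls to `-l`, and the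
winner is then the unique leader. The next challenger is uniform in the set `S` of arms not yet
challenged. When `S` is empty, the last pair plays on and opens round `l + 1`. Scores sum to zero,
so a series winner in round `l` is `N * l - S.card` points away from losing.

Write ρ for `odds`, δ for `drift`, Z for `maxSeries l`. Gambler's ruin: the better arm, `y` points
from losing, loses the series with probability at most ρ^y, and the series lasts at most z/δ duels
on average if the weaker arm is `z` points from losing. So a challenger weaker than the incumbent
costs 1/δ, a stronger one at most Z. Random order keeps the latter rare: if `r` arms of `S` beat the
incumbent, a stronger challenger has uniform rank below `r`, as in the count of records, which gives
a harmonic number H_r, hence log N. The factor 1/(1 - ρ) allows for stronger challengers that lose.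
An incumbent upset by a weaker arm costs at most a further `cap` harmonic units; the chances of this
form a geometric series, since the incumbent's lead grows as `S` shrinks. This is `restCost`.

Duels with the best arm cost nothing. It enters its first series of a round one point from losing
unless it is the incumbent, so it fails with probability at most ρ. After a failure the rest of the
round and the next round up to its appearance are paid, then the same risk recurs; `tail` is the
resulting sum. Round costs grow linearly in `l` against the decay ρ^l, so the total is finite.

Formally, `potential` plus the regret paid is a supermartingale: `potential_drift` handles one duel,
`sum_potential_le` a new challenger, `potential_succ_le` a new round. Induction on the horizon
(`potentialBound`) and evaluation at the start give the bound. -/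

/-! ### Expectations over finite types -/

theorem PMF.lintegral_toMeasure {α : Type*} [Fintype α] [MeasurableSpace α]
    [MeasurableSingletonClass α] (q : PMF α) (g : α → ℝ≥0∞) :
    ∫⁻ a, g a ∂q.toMeasure = ∑ a, q a * g a := by
  rw [lintegral_fintype]
  exact Finset.sum_congr rfl fun a _ => by
    rw [PMF.toMeasure_apply_singleton _ _ (measurableSet_singleton a), mul_comm]

/-- The expectation of a function on a finite type under a probability mass function. -/
noncomputable def PMF.expect {α : Type*} [Fintype α] (q : PMF α) (g : α → ℝ≥0∞) : ℝ≥0∞ :=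
  ∑ a, q a * g a

theorem PMF.expect_bind {α β : Type*} [Fintype α] [Fintype β] (q : PMF α) (f : α → PMF β)
    (g : β → ℝ≥0∞) : (q.bind f).expect g = q.expect fun a => (f a).expect g := by
  simp only [PMF.expect, PMF.bind_apply, tsum_fintype, Finset.sum_mul, Finset.mul_sum]
  rw [Finset.sum_comm]
  simp only [mul_assoc]

theorem PMF.expect_pure {α : Type*} [Fintype α] (a : α) (g : α → ℝ≥0∞) :
    (PMF.pure a).expect g = g a := by
  classical
  simp [PMF.expect, PMF.pure_apply]

theorem PMF.expect_map {α β : Type*} [Fintype α] [Fintype β] (q : PMF α) (f : α → β)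
    (g : β → ℝ≥0∞) : (q.map f).expect g = q.expect (g ∘ f) := by
  rw [PMF.map, PMF.expect_bind]
  simp [PMF.expect_pure, Function.comp_def]

theorem PMF.expect_le_of_support {α : Type*} [Fintype α] (q : PMF α) (g : α → ℝ≥0∞) (c : ℝ≥0∞)
    (hg : ∀ a ∈ q.support, g a ≤ c) : q.expect g ≤ c := by
  calc q.expect g ≤ ∑ a, q a * c := by
        refine Finset.sum_le_sum fun a _ => ?_
        by_cases ha : a ∈ q.support
        · gcongr; exact hg a ha
        · simp [(PMF.apply_eq_zero_iff q a).2 ha]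
    _ = c := by
        rw [← Finset.sum_mul, ← tsum_fintype (L := .unconditional _), q.tsum_coe, one_mul]

theorem PMF.expect_uniformOfFinset {α : Type*} [Fintype α] (S : Finset α) (hS : S.Nonempty)
    (g : α → ℝ≥0∞) :
    (PMF.uniformOfFinset S hS).expect g = (S.card : ℝ≥0∞)⁻¹ * ∑ a ∈ S, g a := by
  classical
  rw [PMF.expect, Finset.mul_sum]
  simp [PMF.uniformOfFinset_apply, ite_mul, Finset.sum_ite_mem]

/-! ### From the law on infinite sequences to a finite-horizon recursion -/

namespace WSW

variable {N : ℕ}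

/-- The history extended by one more duel. -/
def extend {t : ℕ} (h : Fin t → Duel N) (d : Duel N) : Fin (t + 1) → Duel N :=
  Fin.snoc (α := fun _ => Duel N) h d

/-- The expected weak regret of the next `T` duels, given the history. -/
noncomputable def expectedRegret [N.AtLeastTwo] (P : Preference N) :
    ℕ → {t : ℕ} → (Fin t → Duel N) → ℝ≥0∞
  | 0, _, _ => 0
  | T + 1, _, h => (step P h).expect fun d => weakRegret 0 d + expectedRegret P T (extend h d)

/-- The first `n` duels of an infinite sequence of duels. -/
def initialDuels (n : ℕ) (ω : ℕ → Duel N) : Fin n → Duel N := fun s => ω s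

theorem measurable_weakRegret (best : Fin N) : Measurable (weakRegret best) :=
  measurable_of_countable _

theorem extend_initialDuels (n : ℕ) (ω : ℕ → Duel N) :
    extend (initialDuels n ω) (ω n) = initialDuels (n + 1) ω := by
  funext s
  refine Fin.lastCases ?_ (fun i => ?_) s <;> simp [extend, initialDuels]

theorem map_eval_zero_law [N.AtLeastTwo] (P : Preference N) :
    (law P).map (fun ω => ω 0) = (step P (Fin.elim0 : Fin 0 → Duel N)).toMeasure := by
  let e : ((s : Finset.Iic 0) → Duel N) → Duel N := fun x => x ⟨0, Finset.mem_Iic.2 le_rfl⟩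
  have he : Measurable e := measurable_pi_apply _
  have hcomp : (fun ω : ℕ → Duel N => ω 0) = e ∘ Preorder.frestrictLe (π := fun _ => Duel N) 0 :=
    rfl
  rw [hcomp, ← Measure.map_map he (by fun_prop), law, Kernel.trajMeasure,
    Measure.map_comp _ _ (by fun_prop), Kernel.traj_map_frestrictLe, Kernel.partialTraj_self,
    Measure.id_comp, Measure.map_map he (by fun_prop)]
  exact Measure.map_id

/-- The Markov property in integrated form: the first duel is governed by the initial law, each
later one by the kernel at the preceding index. -/
theorem lintegral_law_step [N.AtLeastTwo] (P : Preference N) (n : ℕ)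
    (g : (Fin n → Duel N) → Duel N → ℝ≥0∞) :
    ∫⁻ ω, g (initialDuels n ω) (ω n) ∂(law P) =
      ∫⁻ ω, (step P (initialDuels n ω)).expect (g (initialDuels n ω)) ∂(law P) := by
  cases n with
  | zero =>
    have h0 : ∀ ω : ℕ → Duel N, initialDuels 0 ω = Fin.elim0 := fun ω => Subsingleton.elim _ _
    simp only [h0]
    have : IsProbabilityMeasure (law P) := by unfold law; infer_instance
    rw [lintegral_const, measure_univ, mul_one, PMF.expect, ← PMF.lintegral_toMeasure,
      ← map_eval_zero_law, lintegral_map (measurable_of_countable _) (measurable_pi_apply 0)]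
  | succ n =>
    let G : (((s : Finset.Iic n) → Duel N) × Duel N) → ℝ≥0∞ := fun x => g (history x.1) x.2
    have hG : Measurable G := measurable_of_countable G
    have key := Kernel.map_frestrictLe_trajMeasure_compProd_eq_map_trajMeasure
      (X := fun _ => Duel N) (μ₀ := (step P (Fin.elim0 : Fin 0 → Duel N)).toMeasure)
      (κ := kernel P) (a := n)
    have h1 := congrArg (fun μ => ∫⁻ x, G x ∂μ) key
    rw [Measure.lintegral_compProd hG, lintegral_map (measurable_of_countable _) (by fun_prop),
      lintegral_map hG (by fun_prop)] at h1
    refine Eq.trans ?_ (h1.symm.trans ?_)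
    · rfl
    · refine lintegral_congr fun ω => ?_
      exact PMF.lintegral_toMeasure _ _

/-- Tower property. The starting time `n` stays general because the recursion peels off the earliest
duel. -/
theorem lintegral_sum_weakRegret [N.AtLeastTwo] (P : Preference N) (T n : ℕ) :
    ∫⁻ ω, ∑ t ∈ Finset.range T, weakRegret 0 (ω (n + t)) ∂(law P) =
      ∫⁻ ω, expectedRegret P T (initialDuels n ω) ∂(law P) := by
  induction T generalizing n with
  | zero => simp [expectedRegret]
  | succ T ih =>
    simp only [expectedRegret]
    rw [← lintegral_law_step P n
      fun h d => weakRegret 0 d + expectedRegret P T (extend h d)]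
    simp only [extend_initialDuels]
    have hm : Measurable fun ω : ℕ → Duel N => weakRegret 0 (ω n) :=
      (measurable_weakRegret 0).comp (measurable_pi_apply n)
    rw [lintegral_add_left hm, ← ih (n + 1), ← lintegral_add_left hm]
    refine lintegral_congr fun ω => ?_
    rw [Finset.sum_range_succ', add_comm]
    simp [Nat.add_assoc, Nat.add_comm 1]

theorem lintegral_sum_weakRegret_eq [N.AtLeastTwo] (P : Preference N) (T : ℕ) :
    ∫⁻ ω, ∑ t ∈ Finset.range T, weakRegret 0 (ω t) ∂(law P) =
      expectedRegret P T (Fin.elim0 : Fin 0 → Duel N) := by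
  have h0 : ∀ ω : ℕ → Duel N, initialDuels 0 ω = Fin.elim0 := fun ω => Subsingleton.elim _ _
  have : IsProbabilityMeasure (law P) := by unfold law; infer_instance
  simpa [h0] using lintegral_sum_weakRegret P T 0

end WSW

/-! ### Harmonic numbers and ranks -/

theorem harmonic_mono : Monotone harmonic :=
  monotone_nat_of_le_succ fun n => by
    rw [harmonic_succ]
    have : (0 : ℚ) ≤ ((n + 1 : ℕ) : ℚ)⁻¹ := by positivity
    linarith

theorem sum_range_harmonic (r : ℕ) :
    ∑ j ∈ Finset.range r, (harmonic j : ℝ) = r * (harmonic r : ℝ) - r := by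
  induction r with
  | zero => simp
  | succ r ih =>
    rw [Finset.sum_range_succ, ih, harmonic_succ]
    have : (r : ℝ) + 1 ≠ 0 := by positivity
    push_cast
    field_simp
    ring

namespace WSW

variable {N : ℕ}

theorem card_erase_erase {a b : Fin N} (hab : a ≠ b) :
    ((Finset.univ.erase b).erase a).card + 2 = N := by
  have h1 := Finset.card_erase_add_one (s := Finset.univ.erase b) (a := a) (by simp [hab])
  have h2 := Finset.card_erase_add_one (Finset.mem_univ b)
  rw [Finset.card_univ, Fintype.card_fin] at h2
  omega

/-- The number of elements of `S` that precede `a`, i.e. that are better arms than `a`. -/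
def rank (S : Finset (Fin N)) (a : Fin N) : ℕ := (S.filter (· < a)).card

theorem rank_le (S : Finset (Fin N)) (a : Fin N) : rank S a ≤ N :=
  (Finset.card_le_univ _).trans_eq (Fintype.card_fin N)

theorem rank_mono (S : Finset (Fin N)) : Monotone (rank S) := fun _ _ hab =>
  Finset.card_le_card (Finset.monotone_filter_right S fun _ _ hx => lt_of_lt_of_le hx hab)

theorem rank_erase_le (S : Finset (Fin N)) (a s : Fin N) : rank (S.erase s) a ≤ rank S a :=
  Finset.card_le_card (Finset.filter_subset_filter _ (Finset.erase_subset _ _))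

theorem rank_erase_of_le (S : Finset (Fin N)) {a s : Fin N} (h : a ≤ s) :
    rank (S.erase s) a = rank S a := by
  unfold rank
  congr 1
  ext x
  simp only [Finset.mem_filter, Finset.mem_erase]
  constructor
  · rintro ⟨⟨_, hx⟩, hxa⟩
    exact ⟨hx, hxa⟩
  · rintro ⟨hx, hxa⟩
    exact ⟨⟨(lt_of_lt_of_le hxa h).ne, hx⟩, hxa⟩

/-- The ranks of the elements of `A` within `A` are 0, …, `A.card - 1`, each taken once. -/
theorem sum_rank (f : ℕ → ℝ) (A : Finset (Fin N)) :
    ∑ s ∈ A, f (rank A s) = ∑ j ∈ Finset.range A.card, f j := by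
  induction A using Finset.induction_on_max with
  | empty => simp
  | insert a A hA ih =>
    have ha : a ∉ A := fun h => lt_irrefl a (hA a h)
    rw [Finset.sum_insert ha, Finset.card_insert_of_notMem ha, Finset.sum_range_succ, ← ih, add_comm]
    congr 1
    · refine Finset.sum_congr rfl fun s hs => ?_
      have h := rank_erase_of_le (insert a A) (hA s hs).le
      rw [Finset.erase_insert ha] at h
      rw [h]
    · have h := rank_erase_of_le (insert a A) (le_refl a)
      rw [Finset.erase_insert ha] at h
      rw [← h, rank, Finset.filter_true_of_mem hA]

theorem sum_filter_rank (f : ℕ → ℝ) (S : Finset (Fin N)) (b : Fin N) :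
    ∑ s ∈ S.filter (· < b), f (rank S s) = ∑ j ∈ Finset.range (rank S b), f j := by
  rw [rank, ← sum_rank]
  refine Finset.sum_congr rfl fun s hs => ?_
  have hsb : s < b := (Finset.mem_filter.1 hs).2
  have h : rank S s = rank (S.filter (· < b)) s := by
    unfold rank
    congr 1
    ext x
    simp only [Finset.mem_filter]
    exact ⟨fun hx => ⟨⟨hx.1, hx.2.trans hsb⟩, hx.2⟩, fun hx => ⟨hx.1.1, hx.2⟩⟩
  rw [h]

/-! ### Cost of a series and of a round -/

/-- The numerical data of the potential: the odds ratio of the weaker arm of a pair, the drift of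
the score of the stronger arm, and a bound on the harmonic numbers up to `N`. -/
structure Rates (N : ℕ) where
  odds : ℝ
  drift : ℝ
  cap : ℝ
  odds_nonneg : 0 ≤ odds
  odds_lt_one : odds < 1
  drift_pos : 0 < drift
  harmonic_le : (harmonic N : ℝ) ≤ cap

namespace Rates

variable (c : Rates N)

theorem harmonic_rank_le (S : Finset (Fin N)) (a : Fin N) :
    (harmonic (rank S a) : ℝ) ≤ c.cap :=
  le_trans (by exact_mod_cast harmonic_mono (rank_le S a)) c.harmonic_le

theorem harmonic_cast_nonneg (r : ℕ) : 0 ≤ (harmonic r : ℝ) := by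
  exact_mod_cast (harmonic_mono (Nat.zero_le r)).trans' (by simp)

theorem cap_nonneg : 0 ≤ c.cap := (harmonic_cast_nonneg N).trans c.harmonic_le

theorem one_sub_odds_pos : 0 < 1 - c.odds := sub_pos.2 c.odds_lt_one

theorem odds_pow_le_one (n : ℕ) : c.odds ^ n ≤ 1 := pow_le_one₀ c.odds_nonneg c.odds_lt_one.le

/-- A bound on the expected duration of any series of duels between two arms in round `l`. -/
noncomputable def maxSeries (l : ℕ) : ℝ := N * l / c.drift

theorem maxSeries_nonneg (l : ℕ) : 0 ≤ c.maxSeries l := by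
  have := c.drift_pos
  unfold maxSeries
  positivity

/-- A bound on the expected duration of the rest of round `l` when the arm `a` has just won a series
and the arms in `S` still have to be challenged in this round. -/
noncomputable def restCost (l : ℕ) (S : Finset (Fin N)) (a : Fin N) : ℝ :=
  S.card / c.drift + c.maxSeries l / (1 - c.odds) *
    (harmonic (rank S a) + c.cap * c.odds ^ (N * l - S.card) / (1 - c.odds))

/-- `pairCost` for a pair whose first arm is the better one. -/
noncomputable def orderedCost (l : ℕ) (S : Finset (Fin N)) (a b : Fin N) (y z : ℕ) : ℝ :=
  z / c.drift + c.restCost l S a + c.odds ^ y * (c.restCost l S b - c.restCost l S a)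

/-- A bound on the expected duration of the rest of round `l` during the series of `a` against `b`,
when `a` and `b` are `y` and `z` points away from losing the series. -/
noncomputable def pairCost (l : ℕ) (S : Finset (Fin N)) (a b : Fin N) (y z : ℕ) : ℝ :=
  if a < b then c.orderedCost l S a b y z else c.orderedCost l S b a z y

theorem pairCost_comm (l : ℕ) (S : Finset (Fin N)) {a b : Fin N} (hab : a ≠ b) (y z : ℕ) :
    c.pairCost l S a b y z = c.pairCost l S b a z y := by
  unfold pairCost
  rcases lt_or_gt_of_ne hab with h | h
  · rw [if_pos h, if_neg h.not_gt]
  · rw [if_neg h.not_gt, if_pos h]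

theorem restCost_nonneg (l : ℕ) (S : Finset (Fin N)) (a : Fin N) : 0 ≤ c.restCost l S a := by
  have := c.drift_pos
  have := c.one_sub_odds_pos
  have := c.odds_nonneg
  have := c.cap_nonneg
  have := c.maxSeries_nonneg l
  have := harmonic_cast_nonneg (rank S a)
  unfold restCost
  positivity

theorem restCost_sub (l : ℕ) (S : Finset (Fin N)) (a b : Fin N) :
    c.restCost l S b - c.restCost l S a = c.maxSeries l / (1 - c.odds) *
      (harmonic (rank S b) - harmonic (rank S a)) := by
  unfold restCost
  ring

theorem restCost_mono (l : ℕ) (S : Finset (Fin N)) : Monotone (c.restCost l S) := by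
  intro a b hab
  have h1 : (harmonic (rank S a) : ℝ) ≤ harmonic (rank S b) := by
    exact_mod_cast harmonic_mono (rank_mono S hab)
  have h2 := div_nonneg (c.maxSeries_nonneg l) c.one_sub_odds_pos.le
  nlinarith [c.restCost_sub l S a b, mul_nonneg h2 (sub_nonneg.2 h1)]

theorem restCost_le_orderedCost (l : ℕ) (S : Finset (Fin N)) {a b : Fin N} (hab : a < b)
    (y z : ℕ) : c.restCost l S a ≤ c.orderedCost l S a b y z := by
  have h1 := c.drift_pos
  have h2 := mul_nonneg (pow_nonneg c.odds_nonneg y) (sub_nonneg.2 (c.restCost_mono l S hab.le))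
  have h3 : (0 : ℝ) ≤ z / c.drift := by positivity
  unfold orderedCost
  linarith

theorem pairCost_nonneg (l : ℕ) (S : Finset (Fin N)) {a b : Fin N} (hab : a ≠ b) (y z : ℕ) :
    0 ≤ c.pairCost l S a b y z := by
  rcases lt_or_gt_of_ne hab with h | h
  · rw [pairCost, if_pos h]
    exact (c.restCost_nonneg l S a).trans (c.restCost_le_orderedCost l S h y z)
  · rw [pairCost, if_neg h.not_gt]
    exact (c.restCost_nonneg l S b).trans (c.restCost_le_orderedCost l S h z y)

theorem restCost_le_pairCost (l : ℕ) (S : Finset (Fin N)) {a b : Fin N} (hab : a ≠ b) (z : ℕ) :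
    c.restCost l S b ≤ c.pairCost l S a b 0 z := by
  rcases lt_or_gt_of_ne hab with h | h
  · have h1 := c.drift_pos
    have h3 : (0 : ℝ) ≤ z / c.drift := by positivity
    rw [pairCost, if_pos h, orderedCost, pow_zero]
    linarith
  · rw [pairCost, if_neg h.not_gt]
    exact c.restCost_le_orderedCost l S h z 0

/-- A bound on the expected duration of the rest of round `l` at any start of a series. -/
noncomputable def roundCost (l : ℕ) : ℝ :=
  (N - 1) / c.drift + c.maxSeries l * (1 + c.cap / (1 - c.odds) ^ 2)

theorem roundCost_nonneg [N.AtLeastTwo] (l : ℕ) : 0 ≤ c.roundCost l := by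
  have := c.drift_pos
  have := c.one_sub_odds_pos
  have := c.cap_nonneg
  have := c.maxSeries_nonneg l
  have h : (1 : ℝ) ≤ N := by exact_mod_cast (Nat.AtLeastTwo.prop (n := N)).trans' one_le_two
  have := sub_nonneg.2 h
  unfold roundCost
  positivity

theorem maxSeries_ge {l k : ℕ} (h : k ≤ N * l) : (k : ℝ) / c.drift ≤ c.maxSeries l := by
  have := c.drift_pos
  unfold maxSeries
  gcongr
  exact_mod_cast h

/-- Covers any series whose second arm is one point from losing, whichever arm is better; the costs
of the two possible winners enter as a convex combination. -/
theorem pairCost_le_roundCost {l : ℕ} {S : Finset (Fin N)} {a b : Fin N} (hab : a ≠ b)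
    (haS : a ∉ S) (hbS : b ∉ S) {y : ℕ} (hy : 1 ≤ y) (hsum : y + 1 + S.card = N * l) :
    c.pairCost l S a b y 1 ≤ c.roundCost l := by
  have hδ := c.drift_pos
  have hρ := c.odds_nonneg
  have hw := c.one_sub_odds_pos
  have hh := c.cap_nonneg
  have hZ := c.maxSeries_nonneg l
  have hcard : S.card + 2 ≤ N := by
    have h := Finset.card_le_univ (insert a (insert b S))
    rw [Finset.card_insert_of_notMem (by simp [hab, haS]), Finset.card_insert_of_notMem hbS,
      Fintype.card_fin] at h
    omega
  have hcard' : (S.card : ℝ) + 2 ≤ N := by exact_mod_cast hcard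
  -- The exponent is at least 1, so the bracket is at most cap + cap·ρ/(1 - ρ) = cap/(1 - ρ); this
  -- produces the square in `roundCost`.
  have hexp : N * l - S.card = y + 1 := by omega
  have hpow : c.odds ^ (y + 1) ≤ c.odds := by
    simpa using pow_le_pow_of_le_one hρ c.odds_lt_one.le (show 1 ≤ y + 1 by omega)
  have hcap : ∀ x : Fin N, (harmonic (rank S x) : ℝ) ≤ c.cap := c.harmonic_rank_le S
  have hrest : ∀ H : ℝ, H ≤ c.cap → S.card / c.drift + c.maxSeries l / (1 - c.odds) *
      (H + c.cap * c.odds ^ (N * l - S.card) / (1 - c.odds)) ≤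
      S.card / c.drift + c.maxSeries l * (c.cap / (1 - c.odds) ^ 2) := by
    intro H hH
    rw [hexp]
    have : c.maxSeries l / (1 - c.odds) * (H + c.cap * c.odds ^ (y + 1) / (1 - c.odds)) ≤
        c.maxSeries l / (1 - c.odds) * (c.cap + c.cap * c.odds / (1 - c.odds)) := by
      gcongr
    have h2 : c.maxSeries l / (1 - c.odds) * (c.cap + c.cap * c.odds / (1 - c.odds)) =
        c.maxSeries l * (c.cap / (1 - c.odds) ^ 2) := by
      field_simp
      ring
    linarith
  have hcomb : ∀ (x x' : Fin N) (n : ℕ), c.restCost l S x + c.odds ^ n *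
      (c.restCost l S x' - c.restCost l S x) ≤
      S.card / c.drift + c.maxSeries l * (c.cap / (1 - c.odds) ^ 2) := by
    intro x x' n
    have h0 : 0 ≤ c.odds ^ n := pow_nonneg hρ n
    have h1 := c.odds_pow_le_one n
    have e1 : c.restCost l S x ≤ _ := hrest _ (hcap x)
    have e2 : c.restCost l S x' ≤ _ := hrest _ (hcap x')
    nlinarith
  have hsplit : c.roundCost l = (N - 1) / c.drift + c.maxSeries l +
      c.maxSeries l * (c.cap / (1 - c.odds) ^ 2) := by
    unfold roundCost
    ring
  rw [hsplit]
  rcases lt_or_gt_of_ne hab with h | h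
  · rw [pairCost, if_pos h, orderedCost]
    have h1 : ((1 : ℕ) : ℝ) / c.drift + S.card / c.drift ≤ (N - 1) / c.drift := by
      rw [← add_div]
      gcongr
      push_cast
      linarith
    linarith [hcomb a b y]
  · rw [pairCost, if_neg h.not_gt, orderedCost]
    have h1 : (S.card : ℝ) / c.drift ≤ (N - 1) / c.drift := by
      gcongr
      linarith
    linarith [hcomb b a 1, c.maxSeries_ge (show y ≤ N * l by omega)]

/-- Effect of one challenger. A weaker one is paid by the drop of `S.card` and of the geometric
term; a stronger one costs a long series but lowers the harmonic number with probability at least 1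
- ρ. -/
theorem pairCost_erase_le {l : ℕ} {S : Finset (Fin N)} {b s : Fin N} (hbS : b ∉ S) (hs : s ∈ S)
    {z : ℕ} (hsum : z + S.card = N * l) :
    c.pairCost l (S.erase s) b s z 1 ≤ c.restCost l S b + if s < b then
      c.maxSeries l * (1 + harmonic (rank S s) - harmonic (rank S b)) else 0 := by
  have hδ := c.drift_pos
  have hρ := c.odds_nonneg
  have hw := c.one_sub_odds_pos
  have hh := c.cap_nonneg
  have hZ := c.maxSeries_nonneg l
  have hZw := div_nonneg hZ hw.le
  have hpos : 1 ≤ S.card := Finset.card_pos.2 ⟨s, hs⟩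
  have hcard : ((S.erase s).card : ℝ) = S.card - 1 := by
    rw [Finset.card_erase_of_mem hs, Nat.cast_sub hpos, Nat.cast_one]
  have hexp : N * l - S.card = z := by omega
  have hexp' : N * l - (S.erase s).card = z + 1 := by
    rw [Finset.card_erase_of_mem hs]
    omega
  -- Removing one arm from `S` releases cap·ρ^z, which pays for an upset of probability at most ρ^z.
  have hsplit : c.cap * c.odds ^ z / (1 - c.odds) =
      c.cap * c.odds ^ (z + 1) / (1 - c.odds) + c.cap * c.odds ^ z := by
    rw [pow_succ]
    field_simp
    ring
  have hpow : 0 ≤ c.odds ^ z := pow_nonneg hρ z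
  have hne : b ≠ s := fun h => hbS (h ▸ hs)
  rcases lt_or_gt_of_ne hne with h | h
  · rw [if_neg h.not_gt, pairCost, if_pos h, orderedCost, restCost_sub, restCost, restCost, hcard,
      hexp, hexp', rank_erase_of_le S h.le, hsplit]
    have h1 : (harmonic (rank (S.erase s) s) : ℝ) - harmonic (rank S b) ≤ c.cap :=
      (sub_le_self _ (harmonic_cast_nonneg _)).trans (c.harmonic_rank_le _ _)
    have h2 := mul_le_mul_of_nonneg_left (mul_le_mul_of_nonneg_left h1 hZw) hpow
    have h3 : ((1 : ℕ) : ℝ) / c.drift + (S.card - 1) / c.drift = S.card / c.drift := by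
      push_cast
      ring
    linarith
  · rw [if_pos h, pairCost, if_neg h.not_gt, orderedCost, restCost_sub, restCost, restCost, hcard,
      hexp, hexp', rank_erase_of_le S le_rfl, hsplit, pow_one]
    have h1 : (harmonic (rank (S.erase s) b) : ℝ) ≤ harmonic (rank S b) := by
      exact_mod_cast harmonic_mono (rank_erase_le S b s)
    have h2 := mul_le_mul_of_nonneg_left (mul_le_mul_of_nonneg_left h1 hZw) hρ
    have h3 : (z : ℝ) / c.drift ≤ c.maxSeries l := c.maxSeries_ge (by omega)
    have h4 : ((S.card : ℝ) - 1) / c.drift ≤ S.card / c.drift := by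
      gcongr
      linarith
    have h5 : 0 ≤ c.maxSeries l / (1 - c.odds) * (c.cap * c.odds ^ z) := by positivity
    have h6 : c.maxSeries l = c.maxSeries l / (1 - c.odds) * (1 - c.odds) := by field_simp
    have h7 : c.maxSeries l * (1 + harmonic (rank S s) - harmonic (rank S b)) =
        c.maxSeries l + c.maxSeries l / (1 - c.odds) * (1 - c.odds) *
          (harmonic (rank S s) - harmonic (rank S b)) := by
      rw [← h6]
      ring
    rw [h7]
    linarith

/-- On average over the challenger, long series and harmonic gains cancel: with r = `rank S b`, the
sum of 1 + H_j - H_r over j < r is zero. This identity dictates the harmonic term of `restCost`. -/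
theorem sum_pairCost_le {l : ℕ} {S : Finset (Fin N)} {b : Fin N} (hbS : b ∉ S) {z : ℕ}
    (hsum : z + S.card = N * l) :
    ∑ s ∈ S, c.pairCost l (S.erase s) b s z 1 ≤ S.card * c.restCost l S b := by
  refine (Finset.sum_le_sum fun s hs => c.pairCost_erase_le hbS hs hsum).trans ?_
  rw [Finset.sum_add_distrib, Finset.sum_const, nsmul_eq_mul, ← Finset.sum_filter,
    ← Finset.mul_sum, Finset.sum_sub_distrib, Finset.sum_add_distrib, Finset.sum_const,
    Finset.sum_const, sum_filter_rank fun n => (harmonic n : ℝ), sum_range_harmonic]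
  have hr : ((S.filter (· < b)).card : ℝ) = rank S b := rfl
  simp only [nsmul_eq_mul, hr]
  apply le_of_eq
  ring

/-! ### The potential for the regret -/

/-- The part of the potential that accounts for the rounds after which the best arm is behind:
at each such round `l`, reached with probability at most `odds ^ l`, the rest of this round and the
beginning of the next one are paid. -/
noncomputable def tail (l : ℕ) : ℝ :=
  (2 * ((N - 1) / c.drift) + (1 + 2 * l) * (N / c.drift * (1 + c.cap / (1 - c.odds) ^ 2))) /
    (1 - c.odds) +
  2 * (N / c.drift * (1 + c.cap / (1 - c.odds) ^ 2)) * c.odds / (1 - c.odds) ^ 2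

/-- `tail` is the closed form of the series obtained by unrolling this recurrence, which converges
because `roundCost` is affine in `l`. -/
theorem tail_eq (l : ℕ) :
    c.tail l = c.roundCost l + c.roundCost (l + 1) + c.odds * c.tail (l + 1) := by
  have hw := c.one_sub_odds_pos.ne'
  unfold tail roundCost maxSeries
  generalize 1 + c.cap / (1 - c.odds) ^ 2 = X
  have hδ := c.drift_pos.ne'
  push_cast
  field_simp
  ring

theorem tail_nonneg [N.AtLeastTwo] (l : ℕ) : 0 ≤ c.tail l := by
  have := c.drift_pos
  have := c.one_sub_odds_pos
  have := c.odds_nonneg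
  have := c.cap_nonneg
  have h : (1 : ℝ) ≤ N := by exact_mod_cast (Nat.AtLeastTwo.prop (n := N)).trans' one_le_two
  have := sub_nonneg.2 h
  unfold tail
  positivity

/-- A bound on the expected future regret during the series of `a` against `b` in round `l`. -/
noncomputable def potential [N.AtLeastTwo] (l : ℕ) (S : Finset (Fin N)) (a b : Fin N) (y z : ℕ) :
    ℝ :=
  if a = 0 then c.odds ^ y * c.tail l
  else if b = 0 then c.odds ^ z * c.tail l
  else c.pairCost l S a b y z +
    if (0 : Fin N) ∈ S then c.odds * c.tail l else c.odds * c.tail (l + 1) + c.roundCost (l + 1)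

/-- `q` is the probability that the better arm of a pair wins a duel. -/
theorem odds_pow_drift {q : ℝ} (hq : 1 ≤ q * (1 + c.odds)) (y : ℕ) :
    q * c.odds ^ (y + 2) + (1 - q) * c.odds ^ y ≤ c.odds ^ (y + 1) := by
  have h0 : 0 ≤ c.odds ^ y := pow_nonneg c.odds_nonneg y
  have h1 : 0 ≤ c.odds ^ y * ((1 - c.odds) * (q * (1 + c.odds) - 1)) :=
    mul_nonneg h0 (mul_nonneg c.one_sub_odds_pos.le (sub_nonneg.2 hq))
  -- The roots of qx² - x + (1 - q) are 1 and (1 - q)/q, and `hq` places ρ between them.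
  have e : q * c.odds ^ (y + 2) + (1 - q) * c.odds ^ y =
      c.odds ^ (y + 1) - c.odds ^ y * ((1 - c.odds) * (q * (1 + c.odds) - 1)) := by ring
  linarith

/-- Optional stopping in one-step form: ρ^y is a supermartingale, and z/δ falls by at least 1 per
duel on average. -/
theorem orderedCost_drift {q : ℝ} (hq : 1 ≤ q * (1 + c.odds)) (hd : c.drift ≤ 2 * q - 1)
    (l : ℕ) (S : Finset (Fin N)) {a b : Fin N} (hab : a < b) (y z : ℕ) :
    q * c.orderedCost l S a b (y + 2) z + (1 - q) * c.orderedCost l S a b y (z + 2) + 1 ≤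
      c.orderedCost l S a b (y + 1) (z + 1) := by
  have hδ := c.drift_pos
  have h1 := mul_le_mul_of_nonneg_right (c.odds_pow_drift hq y)
    (sub_nonneg.2 (c.restCost_mono l S hab.le))
  have h2 : 1 ≤ (2 * q - 1) / c.drift := (one_le_div hδ).2 hd
  have h3 : q * ((z : ℝ) / c.drift) + (1 - q) * (((z + 2 : ℕ) : ℝ) / c.drift) +
      (2 * q - 1) / c.drift = ((z + 1 : ℕ) : ℝ) / c.drift := by
    push_cast
    ring
  unfold orderedCost
  linarith

variable [N.AtLeastTwo]

theorem potential_comm (l : ℕ) (S : Finset (Fin N)) {a b : Fin N} (hab : a ≠ b) (y z : ℕ) :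
    c.potential l S a b y z = c.potential l S b a z y := by
  unfold potential
  rw [c.pairCost_comm l S hab]
  by_cases ha : a = 0
  · have hb : b ≠ 0 := fun hb => hab (ha.trans hb.symm)
    simp [ha, hb]
  · simp [ha]

theorem potential_nonneg (l : ℕ) (S : Finset (Fin N)) {a b : Fin N} (hab : a ≠ b) (y z : ℕ) :
    0 ≤ c.potential l S a b y z := by
  have := c.odds_nonneg
  have := c.tail_nonneg l
  have := c.tail_nonneg (l + 1)
  have := c.roundCost_nonneg (l + 1)
  have := c.pairCost_nonneg l S hab y z
  unfold potential
  split_ifs <;> positivity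

/-- If the best arm has just lost (`a = 0`), `tail l` is opened and pays for this round, the next
one and the next risk. If it is absent from the pair, its arrival as challenger costs ρ·`tail l`,
already reserved. -/
theorem sum_potential_le {l : ℕ} {S : Finset (Fin N)} {a b : Fin N} (hab : a ≠ b) (haS : a ∉ S)
    (hbS : b ∉ S) {z : ℕ} (hz : 1 ≤ z) (hsum : z + S.card = N * l) :
    ∑ s ∈ S, c.potential l (S.erase s) b s z 1 ≤ S.card * c.potential l S a b 0 z := by
  by_cases hb : b = 0
  · have ha : a ≠ 0 := fun ha => hab (ha.trans hb.symm)
    simp [potential, hb, ha]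
  have hbs : ∀ s ∈ S, b ≠ s := fun s hs h => hbS (h ▸ hs)
  by_cases ha : a = 0
  · rw [← nsmul_eq_mul]
    refine Finset.sum_le_card_nsmul _ _ _ fun s hs => ?_
    have hs0 : s ≠ 0 := fun h => haS (ha ▸ h ▸ hs)
    have h0 : (0 : Fin N) ∉ S.erase s := fun h => haS (ha ▸ Finset.mem_of_mem_erase h)
    have hcard := Finset.card_erase_add_one hs
    have h1 := c.pairCost_le_roundCost (l := l) (hbs s hs)
      (fun h => hbS (Finset.mem_of_mem_erase h)) (Finset.notMem_erase s S) hz (by omega)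
    rw [potential, if_neg hb, if_neg hs0, if_neg h0, potential, if_pos ha, pow_zero, one_mul,
      c.tail_eq l]
    linarith
  · set K := if (0 : Fin N) ∈ S then c.odds * c.tail l
      else c.odds * c.tail (l + 1) + c.roundCost (l + 1) with hK
    have h1 : ∀ s ∈ S, c.potential l (S.erase s) b s z 1 ≤
        c.pairCost l (S.erase s) b s z 1 + K := by
      intro s hs
      rw [potential, if_neg hb]
      by_cases hs0 : s = 0
      · have h0 : (0 : Fin N) ∈ S := hs0 ▸ hs
        rw [if_pos hs0, hK, if_pos h0, pow_one]
        linarith [c.pairCost_nonneg l (S.erase s) (hbs s hs) z 1]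
      · rw [if_neg hs0, hK]
        simp [Finset.mem_erase, Ne.symm hs0]
    refine (Finset.sum_le_sum h1).trans ?_
    rw [Finset.sum_add_distrib, Finset.sum_const, nsmul_eq_mul, potential, if_neg ha, if_neg hb,
      mul_add]
    refine add_le_add ((c.sum_pairCost_le hbS hsum).trans ?_) le_rfl
    exact mul_le_mul_of_nonneg_left (c.restCost_le_pairCost l S hab z) (Nat.cast_nonneg _)

/-- A new round gives every arm one more point, so a best arm that was beaten restarts at distance 1
and its risk is again ρ. -/
theorem potential_succ_le {l : ℕ} {a b : Fin N} (hab : a ≠ b) {z : ℕ} (hsum : z = N * l) :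
    c.potential (l + 1) ((Finset.univ.erase b).erase a) b a (z + 1) 1 ≤
      c.potential l ∅ a b 0 z := by
  have hρ := c.odds_nonneg
  have hR := c.roundCost_nonneg l
  have hR' := c.roundCost_nonneg (l + 1)
  have hT := c.tail_nonneg (l + 1)
  have hstep := c.tail_eq l
  unfold potential
  by_cases hb : b = 0
  · have ha : a ≠ 0 := fun ha => hab (ha.trans hb.symm)
    rw [if_pos hb, if_neg ha, if_pos hb, pow_succ, mul_assoc]
    exact mul_le_mul_of_nonneg_left (by linarith) (pow_nonneg hρ z)
  · by_cases ha : a = 0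
    · rw [if_neg hb, if_pos ha, if_pos ha, pow_one, pow_zero, one_mul]
      linarith
    · have hcard := card_erase_erase hab
      have h1 := c.pairCost_le_roundCost (l := l + 1) (S := (Finset.univ.erase b).erase a)
        hab.symm (by simp) (by simp) (y := z + 1) (by omega) (by rw [Nat.mul_succ]; omega)
      rw [if_neg hb, if_neg ha, if_neg ha, if_neg hb, if_pos (by simp [Ne.symm ha, Ne.symm hb]),
        if_neg (by simp)]
      linarith [c.pairCost_nonneg l ∅ hab 0 z]

theorem potential_initial_le {a b : Fin N} (hab : a ≠ b) :
    c.potential 1 ((Finset.univ.erase b).erase a) b a 1 1 ≤ c.roundCost 1 + c.odds * c.tail 1 := by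
  have hR := c.roundCost_nonneg 1
  unfold potential
  by_cases hb : b = 0
  · rw [if_pos hb, pow_one]
    linarith
  · by_cases ha : a = 0
    · rw [if_neg hb, if_pos ha, pow_one]
      linarith
    · have hcard := card_erase_erase hab
      have h1 := c.pairCost_le_roundCost (l := 1) (S := (Finset.univ.erase b).erase a)
        hab.symm (by simp) (by simp) (y := 1) le_rfl (by omega)
      rw [if_neg hb, if_neg ha, if_pos (by simp [Ne.symm ha, Ne.symm hb])]
      linarith

theorem potential_drift {q : ℝ} (hq : 1 ≤ q * (1 + c.odds)) (hd : c.drift ≤ 2 * q - 1)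
    (l : ℕ) (S : Finset (Fin N)) {a b : Fin N} (hab : a < b) (y z : ℕ) :
    q * c.potential l S a b (y + 2) z + (1 - q) * c.potential l S a b y (z + 2) +
      (if a = 0 then 0 else 1) ≤ c.potential l S a b (y + 1) (z + 1) := by
  have hb : b ≠ 0 := fun h => by
    subst h
    exact absurd hab (Fin.not_lt_zero a)
  unfold potential
  by_cases ha : a = 0
  · simp only [if_pos ha]
    linarith [mul_le_mul_of_nonneg_right (c.odds_pow_drift hq y) (c.tail_nonneg l)]
  · simp only [if_neg ha, if_neg hb, pairCost, if_pos hab]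
    linarith [c.orderedCost_drift hq hd l S hab y z]

end Rates

/-! ### Evolution of the scores -/

theorem numDefeats_extend {t : ℕ} (h : Fin t → Duel N) (d : Duel N) (a b : Fin N) :
    numDefeats (extend h d) a b = numDefeats h a b + if Defeats d a b then 1 else 0 := by
  rw [numDefeats, numDefeats, Finset.card_filter, Finset.card_filter, Fin.sum_univ_castSucc]
  simp [extend]

theorem lastDuel_extend {t : ℕ} (h : Fin t → Duel N) (d : Duel N) :
    lastDuel (extend h d) = some d := by
  simp [lastDuel, extend]

theorem score_extend {t : ℕ} (h : Fin t → Duel N) {d : Duel N} {w v : Fin N} (hwv : w ≠ v)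
    (hd : d = (w, v, true) ∨ d = (v, w, false)) (x : Fin N) :
    score (extend h d) x = score h x + ((if x = w then 1 else 0) - if x = v then 1 else 0) := by
  have hdef : ∀ a b, Defeats d a b ↔ a = w ∧ b = v := by
    intro a b
    rcases hd with rfl | rfl <;> simp [Defeats, eq_comm, and_comm]
  simp only [score, numDefeats_extend, hdef]
  have h1 : ∀ b, (((numDefeats h x b + if x = w ∧ b = v then 1 else 0 : ℕ) : ℤ) -
      ((numDefeats h b x + if b = w ∧ x = v then 1 else 0 : ℕ) : ℤ)) =
      ((numDefeats h x b : ℤ) - numDefeats h b x) +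
      ((if b = v then if x = w then 1 else 0 else 0) -
        if b = w then if x = v then 1 else 0 else 0) := by
    intro b
    push_cast
    simp only [ite_and]
    split_ifs <;> ring
  rw [Finset.sum_congr rfl fun b _ => h1 b, Finset.sum_add_distrib]
  congr 1
  rw [Finset.sum_sub_distrib, Finset.sum_ite_eq', Finset.sum_ite_eq']
  congr 1
  · by_cases hx : x = w <;> simp [hx, hwv.symm]
  · by_cases hx : x = v <;> simp [hx, hwv]

/-- The scores in round `l` during a series of duels between `a` and `b`: `S` is the set of arms
that are still to be challenged in this round, all other arms have lost a series in this round, and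
`a` and `b` are `y` and `z` points away from losing the series. -/
structure RoundState (C : Fin N → ℤ) (l : ℕ) (S : Finset (Fin N)) (a b : Fin N) (y z : ℕ) :
    Prop where
  ne : a ≠ b
  left_notMem : a ∉ S
  right_notMem : b ∉ S
  left_score : C a + l = y
  right_score : C b + l = z
  unbeaten : ∀ s ∈ S, C s + l = 1
  beaten : ∀ s, s ∉ S → s ≠ a → s ≠ b → C s + l = 0
  total : y + z + S.card = N * l
  round_pos : 1 ≤ l

namespace RoundState

variable {C C' : Fin N → ℤ} {l : ℕ} {S : Finset (Fin N)} {a b : Fin N} {y z : ℕ}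

theorem swap (H : RoundState C l S a b y z) : RoundState C l S b a z y where
  ne := H.ne.symm
  left_notMem := H.right_notMem
  right_notMem := H.left_notMem
  left_score := H.right_score
  right_score := H.left_score
  unbeaten := H.unbeaten
  beaten s h1 h2 h3 := H.beaten s h1 h3 h2
  total := by have := H.total; omega
  round_pos := H.round_pos

theorem left_wins (H : RoundState C l S a b (y + 1) (z + 1))
    (hC : ∀ x, C' x = C x + ((if x = a then 1 else 0) - if x = b then 1 else 0)) :
    RoundState C' l S a b (y + 2) z where
  ne := H.ne
  left_notMem := H.left_notMem
  right_notMem := H.right_notMem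
  left_score := by
    have := H.left_score
    rw [hC, if_pos rfl, if_neg H.ne]
    push_cast at *
    omega
  right_score := by
    have := H.right_score
    rw [hC, if_pos rfl, if_neg H.ne.symm]
    push_cast at *
    omega
  unbeaten s hs := by
    have h1 : s ≠ a := fun h => H.left_notMem (h ▸ hs)
    have h2 : s ≠ b := fun h => H.right_notMem (h ▸ hs)
    rw [hC, if_neg h1, if_neg h2, sub_zero, add_zero]
    exact H.unbeaten s hs
  beaten s hs h1 h2 := by
    rw [hC, if_neg h1, if_neg h2, sub_zero, add_zero]
    exact H.beaten s hs h1 h2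
  total := by have := H.total; omega
  round_pos := H.round_pos

theorem score_le_one (H : RoundState C l S a b y z) {x : Fin N} (ha : x ≠ a) (hb : x ≠ b) :
    C x + l ≤ 1 := by
  by_cases hx : x ∈ S
  · exact (H.unbeaten x hx).le
  · rw [H.beaten x hx ha hb]
    exact zero_le_one

theorem card_add_two_le (H : RoundState C l S a b y z) : S.card + 2 ≤ N := by
  have h := Finset.card_le_univ (insert a (insert b S))
  rw [Finset.card_insert_of_notMem (by simp [H.ne, H.left_notMem]),
    Finset.card_insert_of_notMem H.right_notMem, Fintype.card_fin] at h
  omega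

/-- All other arms are at distance at most 1, so the series winner leads strictly. -/
theorem two_le (H : RoundState C l S a b 0 z) : 2 ≤ z := by
  have h1 := H.card_add_two_le
  have h2 := H.total
  have h3 : N * 1 ≤ N * l := Nat.mul_le_mul_left N H.round_pos
  omega

theorem next_series (H : RoundState C l S a b 0 z) {s : Fin N} (hs : s ∈ S) :
    RoundState C l (S.erase s) b s z 1 where
  ne h := H.right_notMem (h ▸ hs)
  left_notMem h := H.right_notMem (Finset.mem_of_mem_erase h)
  right_notMem := Finset.notMem_erase s S
  left_score := H.right_score
  right_score := by exact_mod_cast H.unbeaten s hs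
  unbeaten x hx := H.unbeaten x (Finset.mem_of_mem_erase hx)
  beaten x hx hb hxs := by
    have hxS : x ∉ S := fun h => hx (Finset.mem_erase.2 ⟨hxs, h⟩)
    by_cases hxa : x = a
    · rw [hxa]
      exact_mod_cast H.left_score
    · exact H.beaten x hxS hxa hb
  total := by
    have h1 := H.total
    have h2 := Finset.card_erase_add_one hs
    omega
  round_pos := H.round_pos

theorem next_round (H : RoundState C l ∅ a b 0 z) :
    RoundState C (l + 1) ((Finset.univ.erase b).erase a) b a (z + 1) 1 where
  ne := H.ne.symm
  left_notMem := by simp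
  right_notMem := by simp
  left_score := by
    have := H.right_score
    push_cast
    omega
  right_score := by
    have := H.left_score
    push_cast at *
    omega
  unbeaten s hs := by
    simp only [Finset.mem_erase, Finset.mem_univ, and_true] at hs
    have := H.beaten s (Finset.notMem_empty s) hs.1 hs.2
    push_cast
    omega
  beaten s hs hb ha := absurd (by simp [ha, hb]) hs
  total := by
    have h1 := H.total
    have h2 := card_erase_erase H.ne
    rw [Finset.card_empty] at h1
    rw [Nat.mul_succ]
    omega
  round_pos := by omega

theorem initial (hC : ∀ x, C x = 0) (hab : a ≠ b) :
    RoundState C 1 ((Finset.univ.erase b).erase a) b a 1 1 where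
  ne := hab.symm
  left_notMem := by simp
  right_notMem := by simp
  left_score := by simp [hC]
  right_score := by simp [hC]
  unbeaten s hs := by simp [hC]
  beaten s hs hb ha := absurd (by simp [ha, hb]) hs
  total := by
    have h2 := card_erase_erase hab
    omega
  round_pos := le_rfl

end RoundState

/-! ### The pairs selected by the algorithm -/

theorem mem_argmaxOn {C : Fin N → ℤ} {S : Finset (Fin N)} {a : Fin N} :
    a ∈ argmaxOn C S ↔ a ∈ S ∧ ∀ b ∈ S, C b ≤ C a := by
  simp [argmaxOn]

theorem tieBreak_fst {a b : Fin N} {r : Bool} {M : Finset (Fin N)} (ha : a ∈ M) :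
    tieBreak (some (a, b, r)) M = {a} := by
  simp [tieBreak, ha]

theorem tieBreak_snd {a b : Fin N} {r : Bool} {M : Finset (Fin N)} (ha : a ∉ M) (hb : b ∈ M) :
    tieBreak (some (a, b, r)) M = {b} := by
  simp [tieBreak, ha, hb]

theorem tieBreak_of_notMem {a b : Fin N} {r : Bool} {M : Finset (Fin N)} (ha : a ∉ M)
    (hb : b ∉ M) : tieBreak (some (a, b, r)) M = M := by
  simp [tieBreak, ha, hb]

theorem tieBreak_singleton (prev : Option (Duel N)) (a : Fin N) : tieBreak prev {a} = {a} := by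
  unfold tieBreak
  split
  · rfl
  · split_ifs with h1 h2
    · rw [Finset.mem_singleton.1 h1]
    · rw [Finset.mem_singleton.1 h2]
    · rfl

theorem tieBreak_subset (prev : Option (Duel N)) (M : Finset (Fin N)) : tieBreak prev M ⊆ M := by
  unfold tieBreak
  split
  · exact Finset.Subset.refl M
  · split_ifs with h1 h2
    · exact Finset.singleton_subset_iff.2 h1
    · exact Finset.singleton_subset_iff.2 h2
    · exact Finset.Subset.refl M

theorem expect_pickArm {t : ℕ} {h : Fin t → Duel N} {S A : Finset (Fin N)} (hS : S.Nonempty)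
    (hA : tieBreak (lastDuel h) (argmaxOn (score h) S) = A) (g : Fin N → ℝ≥0∞) :
    (pickArm h S hS).expect g = (A.card : ℝ≥0∞)⁻¹ * ∑ a ∈ A, g a := by
  subst hA
  exact PMF.expect_uniformOfFinset _ _ g

theorem expect_pickArm_singleton {t : ℕ} {h : Fin t → Duel N} {S : Finset (Fin N)} {a : Fin N}
    (hS : S.Nonempty) (hA : tieBreak (lastDuel h) (argmaxOn (score h) S) = {a})
    (g : Fin N → ℝ≥0∞) : (pickArm h S hS).expect g = g a := by
  simp [expect_pickArm hS hA]

theorem mem_of_mem_support_pickArm {t : ℕ} {h : Fin t → Duel N} {S : Finset (Fin N)}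
    (hS : S.Nonempty) {a : Fin N} (ha : a ∈ (pickArm h S hS).support) : a ∈ S := by
  rw [pickArm, PMF.mem_support_uniformOfFinset_iff] at ha
  exact (mem_argmaxOn.1 (tieBreak_subset _ _ ha)).1

theorem expect_feedback (P : Preference N) (i j : Fin N) (g : Bool → ℝ≥0∞) :
    (feedback P i j).expect g =
      ENNReal.ofReal (P.prob i j) * g true + ENNReal.ofReal (P.prob j i) * g false := by
  simp [PMF.expect, feedback]

/-- The winner of a series is the first arm of the next pair. -/
theorem argmaxOn_univ_of_series_end {t : ℕ} {h : Fin t → Duel N} {l : ℕ}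
    {S : Finset (Fin N)} {a b : Fin N} {z : ℕ} (H : RoundState (score h) l S a b 0 z) :
    argmaxOn (score h) Finset.univ = {b} := by
  have hz := H.two_le
  have h1 := H.left_score
  have h2 := H.right_score
  have hlt : ∀ x, x ≠ b → score h x < score h b := by
    intro x hxb
    by_cases hxa : x = a
    · rw [hxa]
      push_cast at h1
      omega
    · have := H.score_le_one hxa hxb
      omega
  ext x
  rw [mem_argmaxOn, Finset.mem_singleton]
  constructor
  · rintro ⟨_, hx⟩
    by_contra hxb
    exact (hlt x hxb).not_ge (hx b (Finset.mem_univ b))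
  · rintro rfl
    refine ⟨Finset.mem_univ x, fun x' _ => ?_⟩
    by_cases hx' : x' = x
    · rw [hx']
    · exact (hlt x' hx').le

variable [N.AtLeastTwo]

/-- The expected weak regret of the next `T + 1` duels, given the history and the pair of arms that
are pulled next. -/
noncomputable def duelRegret (P : Preference N) (T : ℕ) {t : ℕ} (h : Fin t → Duel N)
    (i j : Fin N) : ℝ≥0∞ :=
  (feedback P i j).expect fun b =>
    weakRegret 0 (i, j, b) + expectedRegret P T (extend h (i, j, b))

theorem expectedRegret_succ (P : Preference N) (T : ℕ) {t : ℕ} (h : Fin t → Duel N) :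
    expectedRegret P (T + 1) h = (pickArm h Finset.univ (univ_nonempty' N)).expect fun i =>
      (pickArm h (Finset.univ.erase i) (erase_nonempty' i)).expect fun j =>
        duelRegret P T h i j := by
  rw [expectedRegret, step, PMF.expect_bind]
  simp only [PMF.expect_bind, PMF.expect_map]
  rfl

/-- As long as neither arm has lost the series, the pair of arms stays the same. -/
theorem expectedRegret_of_continue (P : Preference N) (T : ℕ) {t : ℕ} {h : Fin t → Duel N}
    {l : ℕ} {S : Finset (Fin N)} {a b : Fin N} {y z : ℕ} {r : Bool}
    (hlast : lastDuel h = some (a, b, r))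
    (H : RoundState (score h) l S a b (y + 1) (z + 1)) :
    expectedRegret P (T + 1) h = duelRegret P T h a b ∨
      expectedRegret P (T + 1) h = duelRegret P T h b a := by
  have h1 := H.left_score
  have h2 := H.right_score
  have hle : ∀ x, x ≠ a → x ≠ b → score h x + l ≤ 1 := fun x ha hb => H.score_le_one ha hb
  rw [expectedRegret_succ]
  push_cast at h1 h2
  rcases le_or_gt z y with hzy | hyz
  · left
    rw [expect_pickArm_singleton (a := a), expect_pickArm_singleton (a := b)]
    · rw [hlast]
      refine tieBreak_snd (fun h => by simp [mem_argmaxOn] at h) (mem_argmaxOn.2 ⟨?_, ?_⟩)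
      · simp [H.ne.symm]
      · intro x hx
        by_cases hxb : x = b
        · rw [hxb]
        · have := hle x (Finset.ne_of_mem_erase hx) hxb
          omega
    · rw [hlast]
      refine tieBreak_fst (mem_argmaxOn.2 ⟨Finset.mem_univ a, fun x _ => ?_⟩)
      by_cases hxa : x = a
      · rw [hxa]
      by_cases hxb : x = b
      · rw [hxb]
        omega
      · have := hle x hxa hxb
        omega
  · right
    rw [expect_pickArm_singleton (a := b), expect_pickArm_singleton (a := a)]
    · rw [hlast]
      refine tieBreak_fst (mem_argmaxOn.2 ⟨by simp [H.ne], ?_⟩)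
      intro x hx
      by_cases hxa : x = a
      · rw [hxa]
      · have := hle x hxa (Finset.ne_of_mem_erase hx)
        omega
    · rw [hlast]
      refine tieBreak_snd (fun h => ?_) (mem_argmaxOn.2 ⟨Finset.mem_univ b, fun x _ => ?_⟩)
      · have := (mem_argmaxOn.1 h).2 b (Finset.mem_univ b)
        omega
      by_cases hxb : x = b
      · rw [hxb]
      by_cases hxa : x = a
      · rw [hxa]
        omega
      · have := hle x hxa hxb
        omega

section SeriesEnd

variable {P : Preference N} {t : ℕ} {h : Fin t → Duel N} {l : ℕ} {S : Finset (Fin N)}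
  {a b : Fin N} {z : ℕ}

/-- The winner is already the first arm and the loser lies below `S`, so tie breaking does not
interfere and the challenger is uniform in `S`. -/
theorem expectedRegret_of_series_end (T : ℕ) {r : Bool}
    (hlast : lastDuel h = some (a, b, r) ∨ lastDuel h = some (b, a, r))
    (H : RoundState (score h) l S a b 0 z) (hS : S.Nonempty) :
    expectedRegret P (T + 1) h = (S.card : ℝ≥0∞)⁻¹ * ∑ s ∈ S, duelRegret P T h b s := by
  rw [expectedRegret_succ, expect_pickArm_singleton (a := b), expect_pickArm (A := S)]
  · have hM : argmaxOn (score h) (Finset.univ.erase b) = S := by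
      obtain ⟨s₀, hs₀⟩ := hS
      have hs₀b : s₀ ≠ b := fun h => H.right_notMem (h ▸ hs₀)
      have h0 := H.unbeaten s₀ hs₀
      have h1 := H.left_score
      push_cast at h1
      ext x
      rw [mem_argmaxOn]
      constructor
      · rintro ⟨hx, hmax⟩
        have hle := hmax s₀ (by simp [hs₀b])
        by_contra hxS
        have hx0 : score h x + l = 0 := by
          by_cases hxa : x = a
          · rw [hxa, h1]
          · exact H.beaten x hxS hxa (Finset.ne_of_mem_erase hx)
        omega
      · intro hx
        refine ⟨Finset.mem_erase.2 ⟨fun h => H.right_notMem (h ▸ hx), Finset.mem_univ x⟩, ?_⟩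
        intro x' hx'
        have h2 := H.unbeaten x hx
        by_cases hxa : x' = a
        · rw [hxa]
          omega
        · have := H.score_le_one hxa (Finset.ne_of_mem_erase hx')
          omega
    rw [hM]
    rcases hlast with hlast | hlast
    · rw [hlast, tieBreak_of_notMem H.left_notMem H.right_notMem]
    · rw [hlast, tieBreak_of_notMem H.right_notMem H.left_notMem]
  · rw [argmaxOn_univ_of_series_end H, tieBreak_singleton]

/-- All arms but the winner are tied, and tie breaking retains the previous opponent. -/
theorem expectedRegret_of_round_end (T : ℕ) {r : Bool}
    (hlast : lastDuel h = some (a, b, r) ∨ lastDuel h = some (b, a, r))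
    (H : RoundState (score h) l ∅ a b 0 z) :
    expectedRegret P (T + 1) h = duelRegret P T h b a := by
  rw [expectedRegret_succ, expect_pickArm_singleton (a := b), expect_pickArm_singleton (a := a)]
  · have ha : a ∈ argmaxOn (score h) (Finset.univ.erase b) := by
      refine mem_argmaxOn.2 ⟨by simp [H.ne], fun x hx => ?_⟩
      have h1 := H.left_score
      push_cast at h1
      by_cases hxa : x = a
      · rw [hxa]
      · have := H.beaten x (Finset.notMem_empty x) hxa (Finset.ne_of_mem_erase hx)
        omega
    rcases hlast with hlast | hlast
    · rw [hlast, tieBreak_fst ha]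
    · rw [hlast, tieBreak_snd (fun h => by simp [mem_argmaxOn] at h) ha]
  · rw [argmaxOn_univ_of_series_end H, tieBreak_singleton]

end SeriesEnd

/-! ### Induction on the horizon -/

theorem ofReal_mul_add_le {q x x' u w : ℝ} {X X' R : ℝ≥0∞} (hq0 : 0 ≤ q) (hq1 : q ≤ 1)
    (hx : 0 ≤ x) (hx' : 0 ≤ x') (hu : 0 ≤ u) (hR : R = ENNReal.ofReal u)
    (hX : X ≤ ENNReal.ofReal x) (hX' : X' ≤ ENNReal.ofReal x')
    (hle : q * x + (1 - q) * x' + u ≤ w) :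
    ENNReal.ofReal q * (R + X) + ENNReal.ofReal (1 - q) * (R + X') ≤ ENNReal.ofReal w := by
  have hq1' := sub_nonneg.2 hq1
  calc ENNReal.ofReal q * (R + X) + ENNReal.ofReal (1 - q) * (R + X')
      ≤ ENNReal.ofReal q * (ENNReal.ofReal u + ENNReal.ofReal x) +
        ENNReal.ofReal (1 - q) * (ENNReal.ofReal u + ENNReal.ofReal x') := by
        rw [hR]
        gcongr
    _ = ENNReal.ofReal (q * (u + x) + (1 - q) * (u + x')) := by
        rw [← ENNReal.ofReal_add hu hx, ← ENNReal.ofReal_add hu hx', ← ENNReal.ofReal_mul hq0,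
          ← ENNReal.ofReal_mul hq1', ← ENNReal.ofReal_add (by positivity) (by positivity)]
    _ ≤ ENNReal.ofReal w := ENNReal.ofReal_le_ofReal (by linarith)

/-- The better arm of any pair wins a duel with a probability that is compatible with the odds and
the drift. -/
def Rates.Compatible (c : Rates N) (P : Preference N) : Prop :=
  ∀ i j, i < j → 1 ≤ P.prob i j * (1 + c.odds) ∧ c.drift ≤ 2 * P.prob i j - 1

section Potential

variable {P : Preference N} {c : Rates N} {T : ℕ}

/-- The potential bounds the expected weak regret of the next `T` duels. -/
def PotentialBound (P : Preference N) (c : Rates N) (T : ℕ) : Prop :=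
  ∀ {t : ℕ} {h : Fin t → Duel N} {l : ℕ} {S : Finset (Fin N)} {a b : Fin N} {y z : ℕ} {r : Bool},
    lastDuel h = some (a, b, r) → RoundState (score h) l S a b y z →
    expectedRegret P T h ≤ ENNReal.ofReal (c.potential l S a b y z)

variable {t : ℕ} {h : Fin t → Duel N} {l : ℕ} {S : Finset (Fin N)} {a b : Fin N} {y z : ℕ}

theorem weakRegret_of_lt (hab : a < b) (r : Bool) :
    weakRegret 0 (a, b, r) = ENNReal.ofReal (if a = 0 then 0 else 1) ∧
      weakRegret 0 (b, a, r) = ENNReal.ofReal (if a = 0 then 0 else 1) := by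
  have hb : b ≠ 0 := fun h => by
    subst h
    exact absurd hab (Fin.not_lt_zero a)
  by_cases ha : a = 0 <;> simp [weakRegret, ha, hb]

theorem duelRegret_le_of_lt (hc : c.Compatible P) (ih : PotentialBound P c T) (hab : a < b)
    (H : RoundState (score h) l S a b (y + 1) (z + 1)) :
    duelRegret P T h a b ≤ ENNReal.ofReal (c.potential l S a b (y + 1) (z + 1)) ∧
      duelRegret P T h b a ≤ ENNReal.ofReal (c.potential l S a b (y + 1) (z + 1)) := by
  have hsymm : P.prob b a = 1 - P.prob a b := P.symm b a
  have hq1 : P.prob a b ≤ 1 := by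
    have := P.nonneg b a
    linarith
  obtain ⟨hq, hd⟩ := hc a b hab
  have hu : (0 : ℝ) ≤ if a = 0 then 0 else 1 := by split_ifs <;> norm_num
  have hdrift := c.potential_drift hq hd l S hab y z
  have Ha : ∀ {d : Duel N}, d = (a, b, true) ∨ d = (b, a, false) →
      RoundState (score (extend h d)) l S a b (y + 2) z := fun hd =>
    H.left_wins (score_extend h H.ne hd)
  have Hb : ∀ {d : Duel N}, d = (b, a, true) ∨ d = (a, b, false) →
      RoundState (score (extend h d)) l S a b y (z + 2) := fun hd =>
    (H.swap.left_wins (score_extend h H.ne.symm hd)).swap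
  constructor
  · rw [duelRegret, expect_feedback, hsymm, (weakRegret_of_lt hab true).1,
      (weakRegret_of_lt hab false).1]
    exact ofReal_mul_add_le (P.nonneg a b) hq1 (c.potential_nonneg l S H.ne _ _)
      (c.potential_nonneg l S H.ne _ _) hu rfl (ih (lastDuel_extend h _) (Ha (Or.inl rfl)))
      (ih (lastDuel_extend h _) (Hb (Or.inr rfl))) hdrift
  · rw [duelRegret, expect_feedback, hsymm, (weakRegret_of_lt hab true).2,
      (weakRegret_of_lt hab false).2, add_comm]
    refine ofReal_mul_add_le (P.nonneg a b) hq1 (c.potential_nonneg l S H.ne _ _)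
      (c.potential_nonneg l S H.ne _ _) hu rfl ?_ ?_ hdrift
    · rw [c.potential_comm l S H.ne]
      exact ih (lastDuel_extend h _) (Ha (Or.inr rfl)).swap
    · rw [c.potential_comm l S H.ne]
      exact ih (lastDuel_extend h _) (Hb (Or.inl rfl)).swap

theorem duelRegret_le (hc : c.Compatible P) (ih : PotentialBound P c T)
    (H : RoundState (score h) l S a b (y + 1) (z + 1)) :
    duelRegret P T h a b ≤ ENNReal.ofReal (c.potential l S a b (y + 1) (z + 1)) := by
  rcases lt_or_gt_of_ne H.ne with hab | hab
  · exact (duelRegret_le_of_lt hc ih hab H).1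
  · rw [c.potential_comm l S H.ne]
    exact (duelRegret_le_of_lt hc ih hab H.swap).2

theorem expectedRegret_le_of_series_end (hc : c.Compatible P) (ih : PotentialBound P c T) {r : Bool}
    (hlast : lastDuel h = some (a, b, r) ∨ lastDuel h = some (b, a, r))
    (H : RoundState (score h) l S a b 0 z) :
    expectedRegret P (T + 1) h ≤ ENNReal.ofReal (c.potential l S a b 0 z) := by
  have hz := H.two_le
  have htotal := H.total
  obtain ⟨k, rfl⟩ : ∃ k, z = k + 1 := ⟨z - 1, by omega⟩
  rcases S.eq_empty_or_nonempty with rfl | hS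
  · rw [expectedRegret_of_round_end T hlast H]
    refine (duelRegret_le hc ih H.next_round).trans (ENNReal.ofReal_le_ofReal ?_)
    exact c.potential_succ_le H.ne (by simpa using htotal)
  · rw [expectedRegret_of_series_end T hlast H hS]
    have hcard : (0 : ℝ) < S.card := by exact_mod_cast Finset.card_pos.2 hS
    have hne : ∀ s ∈ S, b ≠ s := fun s hs h => H.right_notMem (h ▸ hs)
    calc (S.card : ℝ≥0∞)⁻¹ * ∑ s ∈ S, duelRegret P T h b s
        ≤ (S.card : ℝ≥0∞)⁻¹ *
          ∑ s ∈ S, ENNReal.ofReal (c.potential l (S.erase s) b s (k + 1) 1) := by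
          gcongr with s hs
          exact duelRegret_le hc ih (H.next_series hs)
      _ = (S.card : ℝ≥0∞)⁻¹ *
          ENNReal.ofReal (∑ s ∈ S, c.potential l (S.erase s) b s (k + 1) 1) := by
          rw [ENNReal.ofReal_sum_of_nonneg fun s hs => c.potential_nonneg l _ (hne s hs) _ _]
      _ ≤ (S.card : ℝ≥0∞)⁻¹ *
          ENNReal.ofReal (S.card * c.potential l S a b 0 (k + 1)) := by
          gcongr
          exact c.sum_potential_le H.ne H.left_notMem H.right_notMem (by omega) (by omega)
      _ = ENNReal.ofReal (c.potential l S a b 0 (k + 1)) := by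
          rw [ENNReal.ofReal_mul hcard.le, ENNReal.ofReal_natCast, ← mul_assoc,
            ENNReal.inv_mul_cancel (by exact_mod_cast hcard.ne') (ENNReal.natCast_ne_top _),
            one_mul]

theorem potentialBound (hc : c.Compatible P) (T : ℕ) : PotentialBound P c T := by
  induction T with
  | zero =>
    intro t h l S a b y z r _ _
    simp [expectedRegret]
  | succ T ih =>
    intro t h l S a b y z r hlast H
    rcases Nat.eq_zero_or_eq_succ_pred y with rfl | hy
    · exact expectedRegret_le_of_series_end hc ih (Or.inl hlast) H
    rcases Nat.eq_zero_or_eq_succ_pred z with rfl | hz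
    · rw [c.potential_comm l S H.ne]
      exact expectedRegret_le_of_series_end hc ih (Or.inr hlast) H.swap
    rw [hy, hz] at H ⊢
    rcases expectedRegret_of_continue P T hlast H with h1 | h1
    · rw [h1]
      exact duelRegret_le hc ih H
    · rw [h1, c.potential_comm l S H.ne]
      exact duelRegret_le hc ih H.swap

theorem expectedRegret_nil_le (hc : c.Compatible P) (T : ℕ) :
    expectedRegret P T (Fin.elim0 : Fin 0 → Duel N) ≤
      ENNReal.ofReal (c.roundCost 1 + c.odds * c.tail 1) := by
  cases T with
  | zero => simp [expectedRegret]
  | succ T =>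
    have h0 : ∀ x : Fin N, score (Fin.elim0 : Fin 0 → Duel N) x = 0 := fun x => by
      simp [score, numDefeats]
    rw [expectedRegret_succ]
    refine PMF.expect_le_of_support _ _ _ fun i _ => ?_
    refine PMF.expect_le_of_support _ _ _ fun j hj => ?_
    have hji : j ≠ i := Finset.ne_of_mem_erase (mem_of_mem_support_pickArm _ hj)
    exact (duelRegret_le hc (potentialBound hc T) (RoundState.initial h0 hji)).trans
      (ENNReal.ofReal_le_ofReal (c.potential_initial_le hji))

end Potential

end WSW

/-! ### The constants in terms of `p` -/

namespace WSW

theorem Rates.initial_eq {N : ℕ} (c : Rates N) :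
    c.roundCost 1 + c.odds * c.tail 1 =
      (N - 1) / c.drift * ((1 + c.odds) / (1 - c.odds)) +
        N / c.drift * (1 + c.cap / (1 - c.odds) ^ 2) * ((1 + c.odds) / (1 - c.odds) ^ 2) := by
  have hw := c.one_sub_odds_pos.ne'
  have hδ := c.drift_pos.ne'
  unfold tail roundCost maxSeries
  generalize 1 + c.cap / (1 - c.odds) ^ 2 = X
  push_cast
  field_simp
  ring

/-- The rates that belong to the minimal winning probability `p` of the better arm. -/
noncomputable def Rates.ofProb (N : ℕ) {p : ℝ} (hp : 1 / 2 < p) (hp1 : p ≤ 1) : Rates N where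
  odds := (1 - p) / p
  drift := 2 * p - 1
  cap := Real.log N + 1
  odds_nonneg := div_nonneg (by linarith) (by linarith)
  odds_lt_one := by
    rw [div_lt_one (by linarith)]
    linarith
  drift_pos := by linarith
  harmonic_le := (harmonic_le_one_add_log N).trans_eq (add_comm _ _)

theorem Rates.ofProb_initial_le {N : ℕ} [N.AtLeastTwo] {p : ℝ} (hp : 1 / 2 < p) (hp1 : p ≤ 1) :
    (ofProb N hp hp1).roundCost 1 + (ofProb N hp hp1).odds * (ofProb N hp hp1).tail 1 ≤
      2 * p ^ 3 / (2 * p - 1) ^ 6 * (N * (Real.log N + 1)) + N / (2 * p - 1) ^ 2 := by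
  have hp0 : 0 < p := by linarith
  have hδ : 0 < 2 * p - 1 := by linarith
  have hN : (1 : ℝ) ≤ N := by exact_mod_cast (Nat.AtLeastTwo.prop (n := N)).trans' one_le_two
  have hlog : 0 ≤ Real.log N := Real.log_nonneg hN
  rw [initial_eq]
  simp only [ofProb]
  have e1 : 1 - (1 - p) / p = (2 * p - 1) / p := by
    field_simp
    ring
  have e2 : 1 + (1 - p) / p = 1 / p := by
    field_simp
    ring
  rw [e1, e2]
  generalize hL : Real.log N + 1 = L
  have hL1 : 1 ≤ L := by linarith
  generalize hd : 2 * p - 1 = d at *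
  have hd1 : d ≤ 1 := by linarith
  have hdp : d ≤ p := by linarith
  have h1 : ((N : ℝ) - 1) / d * (1 / p / (d / p)) ≤ N / d ^ 2 := by
    rw [show ((N : ℝ) - 1) / d * (1 / p / (d / p)) = (N - 1) / d ^ 2 by field_simp]
    gcongr
    linarith
  have h2 : (1 : ℝ) ≤ L / (d / p) ^ 2 := by
    rw [one_le_div (by positivity)]
    exact (pow_le_one₀ (by positivity) ((div_le_one hp0).2 hdp)).trans hL1
  have h3 : (N : ℝ) / d * (1 + L / (d / p) ^ 2) * (1 / p / (d / p) ^ 2) ≤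
      N / d * (2 * (L / (d / p) ^ 2)) * (1 / p / (d / p) ^ 2) := by
    gcongr
    linarith
  have h4 : (N : ℝ) / d * (2 * (L / (d / p) ^ 2)) * (1 / p / (d / p) ^ 2) =
      2 * p ^ 3 / d ^ 5 * (N * L) := by
    field_simp
  -- The argument gives the fifth power of d = 2p - 1; the stated sixth power is weaker since d ≤ 1.
  have h5 : 2 * p ^ 3 / d ^ 5 * (N * L) ≤ 2 * p ^ 3 / d ^ 6 * (N * L) := by
    gcongr ?_ * _
    exact div_le_div_of_nonneg_left (by positivity) (by positivity)
      (pow_le_pow_of_le_one hδ.le hd1 (by norm_num))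
  linarith

theorem Rates.ofProb_compatible {N : ℕ} [N.AtLeastTwo] {P : Preference N} {p : ℝ}
    (hP : P.IsTotalOrder) (hp : P.IsMinWinProb p) (hp2 : 1 / 2 < p) (hp1 : p ≤ 1) :
    (ofProb N hp2 hp1).Compatible P := by
  intro i j hij
  have hle : p ≤ P.prob i j := hp.2 ⟨hP i j hij, i, j, rfl⟩
  have hp0 : 0 < p := by linarith
  constructor
  · have e : 1 + (1 - p) / p = 1 / p := by
      field_simp
      ring
    change 1 ≤ P.prob i j * (1 + (1 - p) / p)
    rw [e, mul_one_div]
    exact (one_le_div hp0).2 hle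
  · change 2 * p - 1 ≤ 2 * P.prob i j - 1
    linarith

theorem lintegral_sum_weakRegret_le {N : ℕ} [N.AtLeastTwo] {P : Preference N} {p : ℝ}
    (hP : P.IsTotalOrder) (hp : P.IsMinWinProb p) (T : ℕ) :
    ∫⁻ ω, ∑ t ∈ Finset.range T, weakRegret 0 (ω t) ∂(law P) ≤
      ENNReal.ofReal (2 * p ^ 3 / (2 * p - 1) ^ 6 * (N * (Real.log N + 1))
        + N / (2 * p - 1) ^ 2) := by
  obtain ⟨hp2, i, j, hij⟩ := hp.1
  have hp1 : p ≤ 1 := by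
    have h1 := P.symm i j
    have h2 := P.nonneg j i
    linarith
  rw [lintegral_sum_weakRegret_eq]
  exact (expectedRegret_nil_le (Rates.ofProb_compatible hP hp hp2 hp1) T).trans
    (ENNReal.ofReal_le_ofReal (Rates.ofProb_initial_le hp2 hp1))

theorem lintegral_tsum_weakRegret_le {N : ℕ} [N.AtLeastTwo] {P : Preference N} {p : ℝ}
    (hP : P.IsTotalOrder) (hp : P.IsMinWinProb p) :
    ∫⁻ ω, ∑' t : ℕ, weakRegret 0 (ω t) ∂(law P) ≤
      ENNReal.ofReal (2 * p ^ 3 / (2 * p - 1) ^ 6 * (N * (Real.log N + 1))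
        + N / (2 * p - 1) ^ 2) := by
  have hm : ∀ t : ℕ, Measurable fun ω : ℕ → Duel N => weakRegret 0 (ω t) := fun t =>
    (measurable_weakRegret 0).comp (measurable_pi_apply t)
  -- The bound is uniform in the horizon, hence passes to the supremum.
  rw [lintegral_tsum fun t => (hm t).aemeasurable, ENNReal.tsum_eq_iSup_nat]
  refine iSup_le fun T => ?_
  rw [← lintegral_finsetSum _ fun t _ => hm t]
  exact lintegral_sum_weakRegret_le hP hp T

end WSW

/-! ### Growth rate and conclusion -/

theorem isBigO_mul_log_add_one (A B : ℝ) :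
    (fun n : ℕ => A * (n * (Real.log n + 1)) + n / B) =O[Filter.atTop]
      fun n : ℕ => (n : ℝ) * Real.log n := by
  have hone : (fun _ : ℕ => (1 : ℝ)) =O[Filter.atTop] fun n : ℕ => Real.log n :=
    ((Real.isLittleO_const_log_atTop (c := 1)).comp_tendsto tendsto_natCast_atTop_atTop).isBigO
  have hn : (fun n : ℕ => (n : ℝ)) =O[Filter.atTop] fun n : ℕ => (n : ℝ) :=
    Asymptotics.isBigO_refl _ _
  have h1 := (hn.mul ((Asymptotics.isBigO_refl _ _).add hone)).const_mul_left A
  have h2 := (hn.mul hone).const_mul_left B⁻¹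
  refine (h1.add h2).congr_left fun n => ?_
  ring

theorem theorem1 (N : ℕ) [N.AtLeastTwo] (P : Preference N) (p : ℝ)
    (hP : P.IsTotalOrder) (hp : P.IsMinWinProb p) :
    (∫⁻ ω, ∑' t : ℕ, WSW.weakRegret 0 (ω t) ∂(WSW.law P) ≤
      ENNReal.ofReal (2 * p ^ 3 / (2 * p - 1) ^ 6 * (N * (Real.log N + 1))
        + N / (2 * p - 1) ^ 2)) ∧
    (∀ T : ℕ, ∫⁻ ω, ∑ t ∈ Finset.range T, WSW.weakRegret 0 (ω t) ∂(WSW.law P) ≤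
      ENNReal.ofReal (2 * p ^ 3 / (2 * p - 1) ^ 6 * (N * (Real.log N + 1))
        + N / (2 * p - 1) ^ 2)) ∧
    (fun n : ℕ => 2 * p ^ 3 / (2 * p - 1) ^ 6 * (n * (Real.log n + 1)) + n / (2 * p - 1) ^ 2)
      =O[Filter.atTop] fun n : ℕ => (n : ℝ) * Real.log n := by
  refine ⟨WSW.lintegral_tsum_weakRegret_le hP hp, WSW.lintegral_sum_weakRegret_le hP hp, ?_⟩
  exact isBigO_mul_log_add_one (2 * p ^ 3 / (2 * p - 1) ^ 6) ((2 * p - 1) ^ 2)
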